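/- Consider one indivisible item and two agents with values $v=(v_1,v_2)\in\mathbb R_{\ge 0}^2$. A mechanism is a randomized map (depending measurably on the reports) from reported values to an allocation of the item to at most one agent together with nonnegative payments $(p_1,p_2)$, which is truthful in expectation (for all $v$ and every misreport of one agent, that agent's expected value minus payment is maximized by reporting truthfully) and ex-post individually rational (under truthful reports every agent's value minus payment is almost surely nonnegative). Its surplus $\mathrm{Surp}_{\mathcal M}(v)$ is the expected sum of the agents' values for what they receive minus their payments. Let $$\mathcal G(v)=\sup_F \mathrm{Opt}_F(v),$$ where $\mathrm{Opt}_F(v)$ is the surplus at $v$ of an anonymous mechanism maximizing expected surplus when both values are drawn independently from the known finite-mean distribution $F$ (the supremum is also taken over such mechanisms if there are several), and let $$\mathcal H(v)=\max\Bigl\{|v_1-v_2|,\ \tfrac{v_1+v_2}{2}\Bigr\}$$ be the better of the Vickrey auction and the uniform lottery. Theorem. Let $v_1,v_2$ be i.i.d. standard exponential, a distribution known to the mechanism. The surplus of every mechanism, $\mathcal G$ and $\mathcal H$ are then integrable, the maximum expected surplus of a mechanism exists and equals $1$, while $$\mathbb E[\mathcal H(v)]=\tfrac54,\qquad \mathcal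 G(w)\ge\mathcal H(w)\ \text{ for every } w\in\mathbb R_{\ge0}^2,\qquad \mathbb E[\mathcal G(v)]\ge\tfrac54 .$$ Consequently, for every $0<\varepsilon<\tfrac54$ and every mechanism $\mathcal M$, neither $$\mathbb E[\mathrm{Surp}_{\mathcal M}(v)]\ \ge\ \frac{\mathbb E[\mathcal G(v)]}{5/4-\varepsilon}\qquad\text{nor}\qquad \mathrm{Surp}_{\mathcal M}(w)\ \ge\ \frac{\mathcal G(w)}{5/4-\varepsilon}\ \text{ for all } w\in\mathbb R_{\ge 0}^2$$ holds, and the same is true with $\mathcal H$ in place of $\mathcal G$. That is, no mechanism for two agents and one item is a $(5/4-\varepsilon)$-approximation to $\mathcal G$, nor to $\mathcal H$, even in expectation over i.i.d. values from a known distribution. -/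

import Mathlib

open MeasureTheory ProbabilityTheory
open scoped NNReal

namespace MoneyBurning

/-- A value profile of the two agents: the (nonnegative) value of each for the single item. -/
abbrev Profile := Fin 2 → ℝ≥0

/-- An allocation of the item: to nobody (`none`) or to agent `i` (`some i`). -/
abbrev Allocation := Option (Fin 2)

instance : MeasurableSpace Allocation := ⊤

/-- An outcome: an allocation together with a vector of nonnegative payments. -/
abbrev Outcome := Allocation × (Fin 2 → ℝ≥0)

/-- Quasilinear utility of agent `i`, whose value for the item is `x`, at the outcome `o`. -/
noncomputable def utility (i : Fin 2) (x : ℝ≥0) (o : Outcome) : ℝ :=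
  (if o.1 = some i then (x : ℝ) else 0) - (o.2 i : ℝ)

/-- A randomized single-item mechanism for two agents: a law on outcomes for every reported
profile, depending measurably on it, that is truthful in expectation and ex-post individually
rational. -/
structure Mechanism where
  rule : Kernel Profile Outcome
  markov : IsMarkovKernel rule
  truthful : ∀ (v : Profile) (i : Fin 2) (b : ℝ≥0),
    ∫ o, utility i (v i) o ∂(rule (Function.update v i b)) ≤ ∫ o, utility i (v i) o ∂(rule v)
  rational : ∀ (v : Profile) (i : Fin 2), ∀ᵐ o ∂(rule v), 0 ≤ utility i (v i) o

/-- The expected (residual) surplus of the mechanism at the profile `v`. -/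
noncomputable def Mechanism.surplus (M : Mechanism) (v : Profile) : ℝ :=
  ∫ o, ∑ i, utility i (v i) o ∂(M.rule v)

/-- The law of a profile of two independent values, each distributed according to `F`. -/
noncomputable def iid (F : Measure ℝ≥0) : Measure Profile := Measure.pi fun _ => F

/-- The expected surplus of the mechanism when the values are i.i.d. from `F`. -/
noncomputable def Mechanism.expectedSurplus (M : Mechanism) (F : Measure ℝ≥0) : ℝ :=
  ∫ v, M.surplus v ∂(iid F)

/-- The outcome seen by relabelled agents: agent `i` gets what agent `σ i` gets in `o`. -/
def relabel (σ : Equiv.Perm (Fin 2)) (o : Outcome) : Outcome :=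
  (o.1.map σ.symm, o.2 ∘ σ)

/-- Anonymity: renaming the agents renames the (random) outcome accordingly. -/
def Mechanism.Anonymous (M : Mechanism) : Prop :=
  ∀ (σ : Equiv.Perm (Fin 2)) (v : Profile), M.rule (v ∘ σ) = (M.rule v).map (relabel σ)

/-- `M` is Bayesian optimal for i.i.d. values from the known distribution `F`: no mechanism has
larger expected surplus. -/
def Mechanism.OptimalFor (M : Mechanism) (F : Measure ℝ≥0) : Prop :=
  ∀ M' : Mechanism, M'.expectedSurplus F ≤ M.expectedSurplus F

/-- The benchmark `𝒢(v) = sup_F Opt_F(v)`: the supremum, over distributions `F` with finite mean,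
of the surplus at `v` of an anonymous mechanism that is Bayesian optimal for i.i.d. values
from `F`. -/
noncomputable def benchmarkG (v : Profile) : ℝ :=
  sSup {s : ℝ | ∃ F : Measure ℝ≥0, IsProbabilityMeasure F ∧ Integrable (fun x : ℝ≥0 => (x : ℝ)) F ∧
    ∃ M : Mechanism, M.Anonymous ∧ M.OptimalFor F ∧ M.surplus v = s}

/-- The better of the Vickrey auction (surplus: larger minus smaller value) and the uniform
lottery (surplus: average value). -/
noncomputable def vickreyOrLottery (v : Profile) : ℝ :=
  max |(v 0 : ℝ) - (v 1 : ℝ)| (((v 0 : ℝ) + (v 1 : ℝ)) / 2)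

/-- `M` is an `α`-approximation to the benchmark `B` at every profile. -/
def Mechanism.Approximates (M : Mechanism) (α : ℝ) (B : Profile → ℝ) : Prop :=
  ∀ v, B v / α ≤ M.surplus v

/-- `M` is an `α`-approximation to the benchmark `B` in expectation over i.i.d. values
from `F`. -/
def Mechanism.ApproximatesOn (M : Mechanism) (F : Measure ℝ≥0) (α : ℝ) (B : Profile → ℝ) : Prop :=
  (∫ v, B v ∂(iid F)) / α ≤ M.expectedSurplus F

/-- The standard exponential distribution, as a distribution of nonnegative values. -/
noncomputable def stdExp : Measure ℝ≥0 := (expMeasure 1).map Real.toNNReal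

end MoneyBurning

/-!
Two facts carry the argument.

*The exponential law makes every allocation equally good.* The truthful utility of an agent is a
convex function of her own value with the winning probability as subgradient, and the hazard rate
of the exponential law is constantly `1`, so her expected utility is at most her expected winning
probability (`integral_utility_le_integral_winProb`). Instead of the envelope formula and an
integration by parts, the proof compares utilities at values `z` and `z + h` and uses that the law
is memoryless. Summing over the agents bounds the expected surplus by the probability that the item
is allocated, hence by `1` (`Mechanism.expectedSurplus_le_one`).

*The benchmark has a closed form.* For a threshold `t`, let agents with values above `t` have
precedence, let a fair coin choose between agents on the same side, and charge `t / 2` in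
expectation for being above. These threshold mechanisms are anonymous and attain the bound `1`, so
all of them are optimal for the exponential law. At values `a ≥ b` the thresholds `b` and `a` yield
the surpluses `a - b / 2` (if `a > b`) and `(a + b) / 2`. Conversely, no anonymous mechanism
surpasses the larger of the two: at the tie `(b, b)` the first agent wins with probability at most
one half, and she earns at most the difference `a - b` times her winning probability at `(a, b)`
more than at the tie (`Mechanism.Anonymous.surplus_le`). So `𝒢` is an explicit piecewise linear
function (`benchmarkG_eq_closedForm`), which shows that it is measurable and integrable and
dominates `ℋ`.

Finally `ℋ = (a + b) / 2 + (a - 3 b)⁺ / 2 + (b - 3 a)⁺ / 2`, and each of the positive parts has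
expectation `E[exp (-3 b)] = 1 / 4`, so `ℋ` has expectation `5 / 4`.
-/

namespace MoneyBurning

/-! ### Interim winning probabilities, payments and utilities -/

lemma measurable_utility (i : Fin 2) (x : ℝ≥0) : Measurable (utility i x) := by
  unfold utility
  refine Measurable.sub (Measurable.ite ?_ measurable_const measurable_const) (by fun_prop)
  exact measurable_fst (measurableSet_singleton (some i))

lemma measurable_relabel (σ : Equiv.Perm (Fin 2)) : Measurable (relabel σ) := by
  have h1 : Measurable fun o : Outcome => o.1.map σ.symm :=
    (measurable_of_countable fun a : Allocation => a.map σ.symm).comp measurable_fst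
  have h2 : Measurable fun o : Outcome => o.2 ∘ σ :=
    measurable_pi_lambda _ fun i => (measurable_pi_apply (σ i)).comp measurable_snd
  exact h1.prodMk h2

namespace Mechanism

variable (M : Mechanism) (v : Profile) (i : Fin 2)

instance : IsMarkovKernel M.rule := M.markov

/-- The probability that agent `i` receives the item at the reports `v`. -/
noncomputable def winProb : ℝ := (M.rule v).real {o | o.1 = some i}

/-- The expected payment of agent `i` at the reports `v`. -/
noncomputable def payment : ℝ := ∫ o, (o.2 i : ℝ) ∂(M.rule v)

lemma measurableSet_wins (i : Fin 2) : MeasurableSet {o : Outcome | o.1 = some i} :=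
  measurable_fst (measurableSet_singleton (some i))

/-- Individual rationality bounds the payment by the value, almost surely. -/
lemma integrable_payment : Integrable (fun o : Outcome => (o.2 i : ℝ)) (M.rule v) := by
  refine Integrable.of_bound (by fun_prop) (v i : ℝ) ?_
  filter_upwards [M.rational v i] with o ho
  unfold utility at ho
  have := (v i).coe_nonneg
  rw [Real.norm_of_nonneg (NNReal.coe_nonneg _)]
  split_ifs at ho <;> linarith

lemma integrable_ite_wins (x : ℝ≥0) :
    Integrable (fun o : Outcome => if o.1 = some i then (x : ℝ) else 0) (M.rule v) := by
  refine Integrable.of_bound (Measurable.aestronglyMeasurable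
    (Measurable.ite (measurableSet_wins i) measurable_const measurable_const)) (x : ℝ) ?_
  refine Filter.Eventually.of_forall fun o => ?_
  split_ifs <;> simp

lemma integral_utility (x : ℝ≥0) :
    ∫ o, utility i x o ∂(M.rule v) = x * M.winProb v i - M.payment v i := by
  unfold utility
  rw [integral_sub _ (M.integrable_payment v i)]
  · congr 1
    have : (fun o : Outcome => if o.1 = some i then (x : ℝ) else 0)
        = {o : Outcome | o.1 = some i}.indicator fun _ => (x : ℝ) := by
      ext o; simp [Set.indicator_apply]
    rw [this, integral_indicator (measurableSet_wins i), setIntegral_const, smul_eq_mul, mul_comm]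
    rfl
  · exact M.integrable_ite_wins v i x

lemma integrable_utility (x : ℝ≥0) : Integrable (utility i x) (M.rule v) := by
  unfold utility
  exact (M.integrable_ite_wins v i x).sub (M.integrable_payment v i)

/-- The expected utility of agent `i` when all reports are the true values `v`. -/
noncomputable def truthfulUtility : ℝ := v i * M.winProb v i - M.payment v i

lemma surplus_eq : M.surplus v = ∑ i, M.truthfulUtility v i := by
  unfold surplus truthfulUtility
  rw [integral_finsetSum _ fun i _ => M.integrable_utility v i (v i)]
  simp only [integral_utility]

lemma winProb_nonneg : 0 ≤ M.winProb v i := measureReal_nonneg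

lemma winProb_le_one : M.winProb v i ≤ 1 := measureReal_le_one

lemma payment_nonneg : 0 ≤ M.payment v i := integral_nonneg fun _ => NNReal.coe_nonneg _

lemma winProb_add_le_one : M.winProb v 0 + M.winProb v 1 ≤ 1 := by
  unfold winProb
  rw [← measureReal_union _ (measurableSet_wins 1)]
  · exact measureReal_le_one
  · rw [Set.disjoint_left]
    intro o h0 h1
    simp only [Set.mem_ofPred_eq] at h0 h1
    simp [h0] at h1

lemma truthfulUtility_nonneg : 0 ≤ M.truthfulUtility v i := by
  rw [truthfulUtility, ← integral_utility]
  exact integral_nonneg_of_ae (M.rational v i)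

lemma truthfulUtility_le_mul : M.truthfulUtility v i ≤ v i * M.winProb v i := by
  unfold truthfulUtility
  linarith [M.payment_nonneg v i]

lemma truthfulUtility_le : M.truthfulUtility v i ≤ v i :=
  (M.truthfulUtility_le_mul v i).trans
    (mul_le_of_le_one_right (NNReal.coe_nonneg _) (M.winProb_le_one v i))

/-- Truthfulness in convex form: the winning probability is a subgradient of the truthful utility
as a function of the agent's own value. The left side is the utility from reporting `b` when the
value is `v i`. -/
lemma subgradient (b : ℝ≥0) :
    M.truthfulUtility (Function.update v i b) i + (v i - b) * M.winProb (Function.update v i b) i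
      ≤ M.truthfulUtility v i := by
  have h := M.truthful v i b
  rw [integral_utility, integral_utility] at h
  unfold truthfulUtility
  rw [Function.update_self]
  linarith

lemma measurable_winProb : Measurable fun v => M.winProb v i :=
  (M.rule.measurable_coe (measurableSet_wins i)).ennreal_toReal

lemma measurable_truthfulUtility : Measurable fun v => M.truthfulUtility v i := by
  have h : Measurable fun v => M.payment v i :=
    (StronglyMeasurable.integral_kernel (κ := M.rule) (f := fun o : Outcome => (o.2 i : ℝ))
      (by fun_prop : Measurable fun o : Outcome => (o.2 i : ℝ)).stronglyMeasurable).measurable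
  have := M.measurable_winProb i
  unfold truthfulUtility
  fun_prop

lemma Anonymous.winProb_eq_of_eq {M : Mechanism} (hM : M.Anonymous) {v : Profile}
    (hv : v 0 = v 1) : M.winProb v 0 = M.winProb v 1 := by
  have h := hM (Equiv.swap 0 1) v
  have hs : v ∘ Equiv.swap (0 : Fin 2) 1 = v := by
    ext i; fin_cases i <;> simp [hv]
  rw [hs] at h
  unfold winProb
  conv_lhs => rw [h]
  rw [map_measureReal_apply (measurable_relabel _) (measurableSet_wins 0)]
  congr 1
  ext o
  rcases o with ⟨_ | j, p⟩
  · simp [relabel]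
  · fin_cases j <;> simp [relabel]

end Mechanism

/-! ### The pointwise upper bound for anonymous mechanisms -/

/-- The closed form of the benchmark `𝒢`: for values `a ≥ b` it is the larger of `a - b / 2` and
`(a + b) / 2`. -/
noncomputable def closedForm (v : Profile) : ℝ :=
  max ((v 0 + v 1 : ℝ) / 4 + 3 / 4 * |(v 0 : ℝ) - v 1|) ((v 0 + v 1 : ℝ) / 2)

lemma Mechanism.Anonymous.truthfulUtility_add_le {M : Mechanism} (hM : M.Anonymous) (v : Profile)
    {i j : Fin 2} (hij : i ≠ j) (hv : v j ≤ v i) :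
    M.truthfulUtility v i + M.truthfulUtility v j
      ≤ max ((v i : ℝ) - v j / 2) ((v i + v j : ℝ) / 2) := by
  set w : Profile := Function.update v i (v j) with hw
  have hwj : w j = v j := by simp [hw, hij.symm]
  have hwi : w i = v j := by simp [hw]
  have hw01 : w 0 = w 1 := by
    fin_cases i <;> fin_cases j <;> simp_all
  have hhalf : M.winProb w i ≤ 1 / 2 := by
    have h1 := hM.winProb_eq_of_eq hw01
    have h2 := M.winProb_add_le_one w
    fin_cases i <;> simp only [Fin.zero_eta, Fin.mk_one] <;> linarith
  have hsum : M.winProb v i + M.winProb v j ≤ 1 := by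
    have := M.winProb_add_le_one v
    fin_cases i <;> fin_cases j <;> (simp_all; try linarith)
  -- passing from the tie `w` to `v` raises the utility of `i` by at most the value difference
  -- times the winning probability at `v`
  have hup := M.subgradient w i (v i)
  have hdown := M.subgradient v i (v j)
  have hback : Function.update w i (v i) = v := by simp [hw]
  rw [hback, hwi] at hup
  rw [← hw] at hdown
  have hv' : (v j : ℝ) ≤ v i := by exact_mod_cast hv
  have h0 := (v j).coe_nonneg
  have hui := M.truthfulUtility_le_mul w i
  rw [hwi] at hui
  have huj := M.truthfulUtility_le_mul v j
  have huii := M.truthfulUtility_le_mul v i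
  have := M.winProb_nonneg v i
  have := M.winProb_le_one v i
  have hj : (v j : ℝ) * M.winProb v j ≤ v j * (1 - M.winProb v i) := by gcongr; linarith
  rcases le_total (M.winProb v i) (1 / 2) with hx | hx
  · apply le_max_of_le_right
    nlinarith
  · have hb : (v j : ℝ) * M.winProb w i ≤ v j * (1 / 2) := by gcongr
    have hd : M.truthfulUtility v i ≤ M.truthfulUtility w i + (v i - v j) * M.winProb v i := by
      linarith
    rcases le_total (2 * (v j : ℝ)) (v i) with h2 | h2
    · apply le_max_of_le_left
      nlinarith
    · apply le_max_of_le_right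
      nlinarith

/-- No anonymous mechanism, optimal or not, exceeds the closed form at any profile: at a tie the
higher agent wins with probability at most one half, and this limits her information rent. -/
lemma Mechanism.Anonymous.surplus_le {M : Mechanism} (hM : M.Anonymous) (v : Profile) :
    M.surplus v ≤ closedForm v := by
  rw [M.surplus_eq, Fin.sum_univ_two, closedForm]
  rcases le_total (v 1) (v 0) with h | h
  · have h' : (v 1 : ℝ) ≤ v 0 := by exact_mod_cast h
    refine (hM.truthfulUtility_add_le v zero_ne_one h).trans_eq ?_
    rw [abs_of_nonneg (by linarith)]
    congr 1
    ring
  · have h' : (v 0 : ℝ) ≤ v 1 := by exact_mod_cast h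
    rw [add_comm]
    refine (hM.truthfulUtility_add_le v one_ne_zero h).trans_eq ?_
    rw [abs_of_nonpos (by linarith)]
    congr 1 <;> ring

lemma vickreyOrLottery_le_closedForm (v : Profile) : vickreyOrLottery v ≤ closedForm v := by
  unfold vickreyOrLottery closedForm
  refine max_le_max ?_ le_rfl
  have : |(v 0 : ℝ) - v 1| ≤ v 0 + v 1 :=
    abs_sub_le_iff.2 ⟨by linarith [(v 1).coe_nonneg], by linarith [(v 0).coe_nonneg]⟩
  linarith

lemma closedForm_nonneg (v : Profile) : 0 ≤ closedForm v :=
  le_max_of_le_right (by positivity)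

lemma closedForm_le_add (v : Profile) : closedForm v ≤ v 0 + v 1 := by
  have : |(v 0 : ℝ) - v 1| ≤ v 0 + v 1 :=
    abs_sub_le_iff.2 ⟨by linarith [(v 1).coe_nonneg], by linarith [(v 0).coe_nonneg]⟩
  have h0 := (v 0).coe_nonneg
  have h1 := (v 1).coe_nonneg
  exact max_le (by linarith) (by linarith)

lemma measurable_closedForm : Measurable closedForm := by
  unfold closedForm
  fun_prop

lemma measurable_vickreyOrLottery : Measurable vickreyOrLottery := by
  unfold vickreyOrLottery
  fun_prop

/-! ### The exponential law -/

instance : IsProbabilityMeasure stdExp := by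
  have := isProbabilityMeasure_expMeasure (r := 1) one_pos
  exact Measure.isProbabilityMeasure_map (by fun_prop)

instance (F : Measure ℝ≥0) [IsProbabilityMeasure F] : IsProbabilityMeasure (iid F) := by
  unfold iid; infer_instance

/-- Integrals against the exponential law as Lebesgue integrals with the density `exp (-y)`. -/
lemma integral_stdExp {f : ℝ≥0 → ℝ} (hf : Measurable f) :
    ∫ z, f z ∂stdExp = ∫ y in Set.Ioi (0 : ℝ), Real.exp (-y) * f y.toNNReal := by
  rw [stdExp, integral_map (by fun_prop) hf.aestronglyMeasurable, expMeasure, gammaMeasure]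
  unfold gammaPDF
  rw [integral_withDensity_eq_integral_toReal_smul (by fun_prop) (by simp),
    ← integral_indicator measurableSet_Ioi]
  refine integral_congr_ae ?_
  filter_upwards [Measure.ae_ne volume (0 : ℝ)] with y hy
  rcases lt_or_gt_of_ne hy with h | h
  · simp [gammaPDFReal, h.not_ge, h.le]
  · simp [gammaPDFReal, h.le, h, ENNReal.toReal_ofReal, Real.exp_nonneg]

/-- The exponential law has no memory. -/
lemma integral_stdExp_add {f : ℝ≥0 → ℝ} (hf : Measurable f) (c : ℝ≥0) :
    ∫ z, f (z + c) ∂stdExp = Real.exp c * ∫ z in Set.Ioi c, f z ∂stdExp := by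
  rw [← integral_indicator measurableSet_Ioi, integral_stdExp (by fun_prop),
    integral_stdExp (hf.indicator measurableSet_Ioi), ← integral_const_mul]
  have h1 : ∫ y in Set.Ioi (0 : ℝ), Real.exp c * (Real.exp (-y)
      * (Set.Ioi c).indicator f y.toNNReal)
      = ∫ y in Set.Ioi (c : ℝ), Real.exp (c - y) * f y.toNNReal := by
    rw [← integral_indicator measurableSet_Ioi, ← integral_indicator measurableSet_Ioi]
    congr 1
    ext y
    by_cases hy : (c : ℝ) < y
    · have h0 : 0 < y := c.coe_nonneg.trans_lt hy
      have hc : c < y.toNNReal := Real.lt_toNNReal_iff_coe_lt.2 hy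
      simp only [Set.indicator, Set.mem_Ioi, h0, hy, hc, if_true, sub_eq_add_neg, Real.exp_add]
      ring
    · have hc : ¬ c < y.toNNReal := fun h => hy (Real.lt_toNNReal_iff_coe_lt.1 h)
      simp [Set.indicator, hy, hc]
  have h2 := (measurePreserving_add_right volume (c : ℝ)).setIntegral_preimage_emb
    (measurableEmbedding_addRight (c : ℝ)) (fun y => Real.exp (c - y) * f y.toNNReal)
    (Set.Ioi (c : ℝ))
  rw [Set.preimage_add_const_Ioi, sub_self] at h2
  rw [h1, ← h2]
  refine setIntegral_congr_fun measurableSet_Ioi fun y hy => ?_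
  have hy' : (0 : ℝ) ≤ y := le_of_lt (show (0 : ℝ) < y from hy)
  simp [Real.toNNReal_add hy' c.coe_nonneg]

lemma integrable_stdExp_coe : Integrable (fun z : ℝ≥0 => (z : ℝ)) stdExp := by
  rw [stdExp, integrable_map_measure (by fun_prop) (by fun_prop), expMeasure, gammaMeasure]
  unfold gammaPDF
  rw [integrable_withDensity_iff_integrable_smul' (by fun_prop) (by simp)]
  have h := (integrable_indicator_iff measurableSet_Ioi).2
    (Real.GammaIntegral_convergent (s := 2) two_pos)
  refine h.congr ?_
  filter_upwards [Measure.ae_ne volume (0 : ℝ)] with y hy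
  rcases lt_or_gt_of_ne hy with h | h
  · simp [h.le, h.not_ge, gammaPDFReal]
  · have : (2 : ℝ) - 1 = 1 := by norm_num
    simp [gammaPDFReal, h.le, h, ENNReal.toReal_ofReal, Real.exp_nonneg, this]

lemma integral_stdExp_coe : ∫ z : ℝ≥0, (z : ℝ) ∂stdExp = 1 := by
  rw [integral_stdExp (by fun_prop)]
  have h := Real.Gamma_eq_integral (s := 2) two_pos
  rw [Real.Gamma_two] at h
  rw [h]
  refine setIntegral_congr_fun measurableSet_Ioi fun y hy => ?_
  have : (2 : ℝ) - 1 = 1 := by norm_num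
  simp [this, le_of_lt (show (0 : ℝ) < y from hy)]

lemma integral_stdExp_exp_neg_three_mul :
    ∫ z : ℝ≥0, Real.exp (-(3 * z)) ∂stdExp = 1 / 4 := by
  rw [integral_stdExp (by fun_prop)]
  have h := integral_exp_mul_Ioi (a := -4) (by norm_num) 0
  rw [setIntegral_congr_fun (g := fun y => Real.exp (-4 * y)) measurableSet_Ioi, h]
  · norm_num
  · intro y hy
    simp only [Real.coe_toNNReal y (le_of_lt hy), ← Real.exp_add]
    congr 1; ring

/-- Integrals of positive parts only see the values above the threshold, where the law starts
afresh. -/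
lemma integral_stdExp_max_sub (c : ℝ≥0) :
    ∫ z : ℝ≥0, max ((z : ℝ) - c) 0 ∂stdExp = Real.exp (-c) := by
  have h := integral_stdExp_add (f := fun z => max ((z : ℝ) - c) 0) (by fun_prop) c
  have h1 : ∫ z in Set.Ioi c, max ((z : ℝ) - c) 0 ∂stdExp
      = ∫ z : ℝ≥0, max ((z : ℝ) - c) 0 ∂stdExp := by
    refine setIntegral_eq_integral_of_forall_compl_eq_zero fun z hz => ?_
    have hz' : z ≤ c := not_lt.1 hz
    have : (z : ℝ) ≤ c := by exact_mod_cast hz'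
    exact max_eq_right (by linarith)
  simp only [NNReal.coe_add, add_sub_cancel_right, NNReal.coe_nonneg, max_eq_left,
    integral_stdExp_coe] at h
  rw [← h1, Real.exp_neg]
  exact eq_inv_of_mul_eq_one_right h.symm

lemma stdExp_real_Ioi (c : ℝ≥0) : stdExp.real (Set.Ioi c) = Real.exp (-c) := by
  have h := integral_stdExp_add (f := fun _ => (1 : ℝ)) (by fun_prop) c
  simp only [integral_const, probReal_univ, smul_eq_mul, mul_one, measureReal_restrict_apply_univ]
    at h
  rw [Real.exp_neg]
  exact eq_inv_of_mul_eq_one_right h.symm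

/-! ### Information rents under the exponential law -/

/-- If `x` is a subgradient of the utility `u` of an agent, then her expected utility is at most
the probability that she wins. Comparing `u (z + h)` with `u z` and integrating, the memoryless law
turns the shift by `h` into a factor `exp h`; then `h` tends to zero. -/
lemma integral_utility_le_integral_winProb {u x : ℝ≥0 → ℝ} (hu : Measurable u)
    (hx : Measurable x) (hu0 : ∀ z, 0 ≤ u z) (huz : ∀ z, u z ≤ z) (hx0 : ∀ z, 0 ≤ x z)
    (hx1 : ∀ z, x z ≤ 1) (hux : ∀ z h, u (z + h) ≤ u z + h * x (z + h)) :
    ∫ z, u z ∂stdExp ≤ ∫ z, x z ∂stdExp := by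
  have hui : Integrable u stdExp := integrable_stdExp_coe.mono' hu.aestronglyMeasurable
    (.of_forall fun z => by rw [Real.norm_of_nonneg (hu0 z)]; exact huz z)
  have hxi : Integrable x stdExp := .of_bound hx.aestronglyMeasurable 1
    (.of_forall fun z => by rw [Real.norm_of_nonneg (hx0 z)]; exact hx1 z)
  set U := ∫ z, u z ∂stdExp
  set X := ∫ z, x z ∂stdExp
  have hU : 0 ≤ U := integral_nonneg hu0
  have key : ∀ h : ℝ≥0, 0 < h → U ≤ Real.exp h * (X + h) := by
    intro h hh
    have hxhi : Integrable (fun z => (h : ℝ) * x (z + h)) stdExp := by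
      refine .of_bound (Measurable.aestronglyMeasurable (by fun_prop)) (h : ℝ) (.of_forall fun z => ?_)
      rw [Real.norm_of_nonneg (mul_nonneg h.coe_nonneg (hx0 _))]
      exact mul_le_of_le_one_right h.coe_nonneg (hx1 _)
    have huhi : Integrable (fun z => u (z + h)) stdExp :=
      (hui.add hxhi).mono' (Measurable.aestronglyMeasurable (by fun_prop)) (.of_forall fun z => by
        rw [Real.norm_of_nonneg (hu0 _)]; exact hux z h)
    have h1 : ∫ z, u (z + h) ∂stdExp ≤ U + h * ∫ z, x (z + h) ∂stdExp := by
      rw [← integral_const_mul, ← integral_add hui hxhi]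
      exact integral_mono huhi (hui.add hxhi) fun z => hux z h
    rw [integral_stdExp_add hu, integral_stdExp_add hx] at h1
    have h2 : ∫ z in Set.Ioi h, x z ∂stdExp ≤ X :=
      setIntegral_le_integral hxi (.of_forall hx0)
    have h3 : U = ∫ z in Set.Ioi h, u z ∂stdExp + ∫ z in (Set.Ioi h)ᶜ, u z ∂stdExp :=
      (integral_add_compl measurableSet_Ioi hui).symm
    have h4 : ∫ z in (Set.Ioi h)ᶜ, u z ∂stdExp ≤ h * h := by
      have hm : stdExp.real (Set.Ioi h)ᶜ ≤ h := by
        rw [probReal_compl_eq_one_sub measurableSet_Ioi, stdExp_real_Ioi]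
        linarith [Real.add_one_le_exp (-(h : ℝ))]
      calc ∫ z in (Set.Ioi h)ᶜ, u z ∂stdExp ≤ ∫ _ in (Set.Ioi h)ᶜ, (h : ℝ) ∂stdExp := by
            refine setIntegral_mono_on hui.integrableOn (by simp) measurableSet_Ioi.compl ?_
            intro z hz
            have hz' : z ≤ h := not_lt.1 (Set.notMem_of_mem_compl hz)
            exact (huz z).trans (by exact_mod_cast hz')
        _ = stdExp.real (Set.Ioi h)ᶜ * h := by simp
        _ ≤ h * h := by gcongr
    have hh' : (0 : ℝ) < h := by exact_mod_cast hh
    have he := Real.add_one_le_exp (h : ℝ)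
    have hepos := Real.exp_pos (h : ℝ)
    have h5 : Real.exp h * (U - h * h) ≤ U + h * (Real.exp h * X) :=
      calc Real.exp h * (U - h * h) ≤ Real.exp h * ∫ z in Set.Ioi h, u z ∂stdExp := by
            gcongr; linarith
        _ ≤ _ := h1
        _ ≤ _ := by gcongr
    have h6 : (h : ℝ) * U ≤ h * (Real.exp h * (X + h)) := by nlinarith
    exact le_of_mul_le_mul_left h6 hh'
  have hlim : Filter.Tendsto (fun h : ℝ => Real.exp h * (X + h)) (nhdsWithin 0 (Set.Ioi 0))
      (nhds (Real.exp 0 * (X + 0))) :=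
    ((by fun_prop : Continuous fun h : ℝ => Real.exp h * (X + h)).tendsto 0).mono_left
      nhdsWithin_le_nhds
  rw [Real.exp_zero, one_mul, add_zero] at hlim
  refine ge_of_tendsto hlim ?_
  filter_upwards [self_mem_nhdsWithin] with h hh
  exact key ⟨h, le_of_lt hh⟩ hh

/-! ### Independent values -/

/-- Drawing one coordinate of an i.i.d. profile afresh does not change its law. -/
lemma measurePreserving_update (F : Measure ℝ≥0) [IsProbabilityMeasure F] (i : Fin 2) :
    MeasurePreserving (fun q : Profile × ℝ≥0 => Function.update q.1 i q.2)
      ((iid F).prod F) (iid F) := by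
  have hm : Measurable fun q : Profile × ℝ≥0 => Function.update q.1 i q.2 := by
    refine measurable_pi_lambda _ fun j => ?_
    by_cases h : j = i
    · subst h; simpa using measurable_snd
    · simp only [Function.update_of_ne h]; fun_prop
  refine ⟨hm, (Measure.pi_eq fun s hs => ?_).symm⟩
  rw [Measure.map_apply hm (.univ_pi hs)]
  have : (fun q : Profile × ℝ≥0 => Function.update q.1 i q.2) ⁻¹' Set.univ.pi s
      = (Set.univ.pi (Function.update s i Set.univ)) ×ˢ s i := by
    ext ⟨w, z⟩
    fin_cases i <;> simp [Fin.forall_fin_two, and_comm]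
  rw [this, Measure.prod_prod, iid, Measure.pi_pi]
  fin_cases i <;> simp [Fin.prod_univ_two, mul_comm]

lemma integral_iid_eq_integral_update (F : Measure ℝ≥0) [IsProbabilityMeasure F] (i : Fin 2)
    {f : Profile → ℝ} (hf : Integrable f (iid F)) :
    ∫ v, f v ∂(iid F) = ∫ w, ∫ z, f (Function.update w i z) ∂F ∂(iid F) := by
  have h := measurePreserving_update F i
  rw [← integral_prod (fun q : Profile × ℝ≥0 => f (Function.update q.1 i q.2))
    (h.integrable_comp_of_integrable hf), ← h.map_eq, integral_map h.measurable.aemeasurable]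
  · rw [h.map_eq]
  · rw [h.map_eq]; exact hf.aestronglyMeasurable

lemma integral_iid_eval (F : Measure ℝ≥0) [IsProbabilityMeasure F] (i : Fin 2)
    {f : ℝ≥0 → ℝ} (hf : Measurable f) : ∫ v, f (v i) ∂(iid F) = ∫ z, f z ∂F := by
  have h := measurePreserving_eval (fun _ : Fin 2 => F) i
  conv_rhs => rw [← h.map_eq]
  rw [integral_map h.measurable.aemeasurable hf.aestronglyMeasurable]
  rfl

lemma integrable_iid_eval (F : Measure ℝ≥0) [IsProbabilityMeasure F] (i : Fin 2)
    {f : ℝ≥0 → ℝ} (hf : Integrable f F) : Integrable (fun v => f (v i)) (iid F) :=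
  (measurePreserving_eval (fun _ : Fin 2 => F) i).integrable_comp_of_integrable hf

lemma integrable_value (i : Fin 2) : Integrable (fun v : Profile => (v i : ℝ)) (iid stdExp) :=
  integrable_iid_eval stdExp i integrable_stdExp_coe

lemma integrable_of_le_add {f : Profile → ℝ} (hf : Measurable f) (h0 : ∀ v, 0 ≤ f v)
    (h1 : ∀ v, f v ≤ v 0 + v 1) : Integrable f (iid stdExp) :=
  ((integrable_value 0).add (integrable_value 1)).mono' hf.aestronglyMeasurable
    (.of_forall fun v => by rw [Real.norm_of_nonneg (h0 v)]; exact h1 v)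

/-! ### The optimal expected surplus -/

namespace Mechanism

variable (M : Mechanism)

lemma integrable_truthfulUtility (i : Fin 2) :
    Integrable (fun v => M.truthfulUtility v i) (iid stdExp) :=
  (integrable_value i).mono' (M.measurable_truthfulUtility i).aestronglyMeasurable
    (.of_forall fun v => by
      rw [Real.norm_of_nonneg (M.truthfulUtility_nonneg v i)]; exact M.truthfulUtility_le v i)

lemma integrable_winProb (i : Fin 2) : Integrable (fun v => M.winProb v i) (iid stdExp) :=
  .of_bound (M.measurable_winProb i).aestronglyMeasurable 1 (.of_forall fun v => by
    rw [Real.norm_of_nonneg (M.winProb_nonneg v i)]; exact M.winProb_le_one v i)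

lemma integrable_surplus : Integrable M.surplus (iid stdExp) := by
  rw [show M.surplus = fun v => ∑ i, M.truthfulUtility v i from funext M.surplus_eq]
  exact integrable_finsetSum _ fun i _ => M.integrable_truthfulUtility i

lemma integral_truthfulUtility_le (i : Fin 2) :
    ∫ v, M.truthfulUtility v i ∂(iid stdExp) ≤ ∫ v, M.winProb v i ∂(iid stdExp) := by
  have hu := (measurePreserving_update stdExp i).integrable_comp_of_integrable
    (M.integrable_truthfulUtility i)
  have hx := (measurePreserving_update stdExp i).integrable_comp_of_integrable
    (M.integrable_winProb i)
  rw [integral_iid_eq_integral_update _ i (M.integrable_truthfulUtility i),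
    integral_iid_eq_integral_update _ i (M.integrable_winProb i)]
  refine integral_mono hu.integral_prod_left hx.integral_prod_left fun w => ?_
  have hm : Measurable fun z => Function.update w i z := measurable_update w
  refine integral_utility_le_integral_winProb ((M.measurable_truthfulUtility i).comp hm)
    ((M.measurable_winProb i).comp hm) (fun z => M.truthfulUtility_nonneg _ _) (fun z => ?_)
    (fun z => M.winProb_nonneg _ _) (fun z => M.winProb_le_one _ _) (fun z h => ?_)
  · simpa using M.truthfulUtility_le (Function.update w i z) i
  · have := M.subgradient (Function.update w i z) i (z + h)
    simp only [Function.update_idem, Function.update_self, NNReal.coe_add] at this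
    linarith

/-- The hazard rate of the exponential law is `1`, so the expected surplus is at most the
probability of allocating the item. -/
lemma expectedSurplus_le_one : M.expectedSurplus stdExp ≤ 1 := by
  unfold expectedSurplus
  simp only [M.surplus_eq, Fin.sum_univ_two]
  rw [integral_add (M.integrable_truthfulUtility 0) (M.integrable_truthfulUtility 1)]
  refine (add_le_add (M.integral_truthfulUtility_le 0) (M.integral_truthfulUtility_le 1)).trans ?_
  rw [← integral_add (M.integrable_winProb 0) (M.integrable_winProb 1)]
  calc ∫ v, (M.winProb v 0 + M.winProb v 1) ∂(iid stdExp) ≤ ∫ _, (1 : ℝ) ∂(iid stdExp) :=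
        integral_mono ((M.integrable_winProb 0).add (M.integrable_winProb 1))
          (integrable_const 1) M.winProb_add_le_one
    _ = 1 := by simp

end Mechanism

/-! ### The expectation of the better of Vickrey and lottery -/

lemma integrable_max_sub_three_mul (i j : Fin 2) :
    Integrable (fun v : Profile => max ((v i : ℝ) - 3 * v j) 0) (iid stdExp) := by
  refine (integrable_value i).mono' (by fun_prop) (.of_forall fun v => ?_)
  rw [Real.norm_of_nonneg (le_max_right _ _)]
  exact max_le (by linarith [(v j).coe_nonneg]) (v i).coe_nonneg

lemma integral_max_sub_three_mul {i j : Fin 2} (hij : i ≠ j) :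
    ∫ v : Profile, max ((v i : ℝ) - 3 * v j) 0 ∂(iid stdExp) = 1 / 4 := by
  have hint := integrable_max_sub_three_mul i j
  rw [integral_iid_eq_integral_update _ i hint]
  simp only [Function.update_self, Function.update_of_ne hij.symm]
  rw [← integral_stdExp_exp_neg_three_mul, ← integral_iid_eval stdExp j (by fun_prop)]
  congr 1
  ext w
  simpa using integral_stdExp_max_sub (3 * w j)

lemma integral_vickreyOrLottery : ∫ v, vickreyOrLottery v ∂(iid stdExp) = 5 / 4 := by
  -- the Vickrey auction is the better one exactly if one value is three times the other
  have hdec : ∀ v : Profile, vickreyOrLottery v = ((v 0 : ℝ) + v 1) / 2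
      + (max ((v 0 : ℝ) - 3 * v 1) 0 / 2 + max ((v 1 : ℝ) - 3 * v 0) 0 / 2) := by
    intro v
    have h0 := (v 0).coe_nonneg
    have h1 := (v 1).coe_nonneg
    unfold vickreyOrLottery
    grind
  have hint := integrable_max_sub_three_mul
  simp only [hdec]
  have hsum : Integrable (fun v : Profile => ((v 0 : ℝ) + v 1) / 2) (iid stdExp) :=
    ((integrable_value 0).add (integrable_value 1)).div_const 2
  have hexc : Integrable (fun v : Profile => max ((v 0 : ℝ) - 3 * v 1) 0 / 2
      + max ((v 1 : ℝ) - 3 * v 0) 0 / 2) (iid stdExp) :=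
    ((hint 0 1).div_const 2).add ((hint 1 0).div_const 2)
  rw [integral_add hsum hexc, integral_add ((hint 0 1).div_const 2) ((hint 1 0).div_const 2),
    integral_div, integral_div,
    integral_div, integral_add (integrable_value 0) (integrable_value 1),
    integral_max_sub_three_mul zero_ne_one, integral_max_sub_three_mul one_ne_zero,
    integral_iid_eval stdExp 0 (f := fun z => (z : ℝ)) (by fun_prop),
    integral_iid_eval stdExp 1 (f := fun z => (z : ℝ)) (by fun_prop), integral_stdExp_coe]
  norm_num

/-! ### Threshold mechanisms -/

/-- The winner when agent `k` has priority: agents above the threshold `t` come before the others,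
and `k` wins ties. The other agent is written `k + 1` in `Fin 2`. -/
noncomputable def thresholdWinner (t : ℝ≥0) (v : Profile) (k : Fin 2) : Fin 2 :=
  if t < v k ∨ v (k + 1) ≤ t then k else k + 1

/-- The outcome when agent `k` has priority. A winner above the threshold pays `t` if the other
agent is above it as well, and `t / 2` otherwise. -/
noncomputable def thresholdOutcome (t : ℝ≥0) (v : Profile) (k : Fin 2) : Outcome :=
  (some (thresholdWinner t v k), fun i =>
    if i = thresholdWinner t v k ∧ t < v i then (if t < v (i + 1) then t else t / 2) else 0)

lemma measurable_thresholdOutcome (t : ℝ≥0) (k : Fin 2) :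
    Measurable fun v => thresholdOutcome t v k := by
  have habove : ∀ i : Fin 2, MeasurableSet {v : Profile | t < v i} := fun i =>
    measurableSet_lt measurable_const (measurable_pi_apply i)
  have hbelow : ∀ i : Fin 2, MeasurableSet {v : Profile | v i ≤ t} := fun i =>
    measurableSet_le (measurable_pi_apply i) measurable_const
  have hw : Measurable fun v => thresholdWinner t v k :=
    Measurable.ite ((habove k).union (hbelow (k + 1))) measurable_const measurable_const
  refine Measurable.prodMk ((measurable_of_countable
    (some : Fin 2 → Allocation)).comp hw) (measurable_pi_lambda _ fun i => ?_)
  refine Measurable.ite (MeasurableSet.inter ?_ (habove i))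
    (Measurable.ite (habove (i + 1)) measurable_const measurable_const) measurable_const
  exact measurableSet_eq_fun measurable_const hw

/-- The threshold rule: priority is given to either agent by a fair coin. -/
noncomputable def thresholdRule (t : ℝ≥0) : Kernel Profile Outcome where
  toFun v := (2⁻¹ : ENNReal) •
    (Measure.dirac (thresholdOutcome t v 0) + Measure.dirac (thresholdOutcome t v 1))
  measurable' := by
    refine Measure.measurable_of_measurable_coe _ fun s hs => ?_
    have h : ∀ k, Measurable fun v => Measure.dirac (thresholdOutcome t v k) s := fun k =>
      (Measure.measurable_coe hs).comp
        (Measure.measurable_dirac.comp (measurable_thresholdOutcome t k))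
    exact ((h 0).add (h 1)).const_mul _

lemma thresholdRule_apply (t : ℝ≥0) (v : Profile) : thresholdRule t v = (2⁻¹ : ENNReal) •
    (Measure.dirac (thresholdOutcome t v 0) + Measure.dirac (thresholdOutcome t v 1)) := rfl

lemma integral_thresholdRule (t : ℝ≥0) (v : Profile) (f : Outcome → ℝ) :
    ∫ o, f o ∂(thresholdRule t v)
      = (f (thresholdOutcome t v 0) + f (thresholdOutcome t v 1)) / 2 := by
  rw [thresholdRule_apply, integral_smul_measure,
    integral_add_measure (integrable_dirac (by simp)) (integrable_dirac (by simp)),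
    integral_dirac, integral_dirac]
  simp
  ring

lemma utility_thresholdOutcome_nonneg (t : ℝ≥0) (v : Profile) (k i : Fin 2) :
    0 ≤ utility i (v i) (thresholdOutcome t v k) := by
  unfold utility thresholdOutcome
  have ht := t.coe_nonneg
  simp only [Option.some_inj]
  by_cases hi : i = thresholdWinner t v k
  · by_cases hv : t < v i
    · have hv' : (t : ℝ) < v i := by exact_mod_cast hv
      rw [if_pos hi.symm, if_pos ⟨hi, hv⟩]
      split_ifs
      · linarith
      · push_cast; linarith
    · simp [← hi, hv]
  · simp [hi, Ne.symm hi]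

/-- The expected utility is a sum of a term that the agent does not control and the utility of
buying one half of the item at the posted unit price `t`. -/
lemma integral_utility_thresholdRule (t : ℝ≥0) (v : Profile) (i : Fin 2) (x : ℝ≥0) :
    ∫ o, utility i x o ∂(thresholdRule t v)
      = (if v (i + 1) ≤ t then (x : ℝ) / 2 else 0)
        + (if t < v i then ((x : ℝ) - t) / 2 else 0) := by
  rw [integral_thresholdRule]
  unfold utility thresholdOutcome thresholdWinner
  simp only [← not_lt]
  by_cases h0 : t < v 0 <;> by_cases h1 : t < v 1 <;> fin_cases i <;>
    simp [h0, h1] <;> ring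

/-- The threshold mechanism: of two agents on different sides of the threshold `t` the higher one
wins, otherwise the winner is drawn by a fair coin. An agent above the threshold pays `t / 2` in
expectation. -/
noncomputable def thresholdMechanism (t : ℝ≥0) : Mechanism where
  rule := thresholdRule t
  markov := ⟨fun v => ⟨by
    rw [thresholdRule_apply, Measure.smul_apply, Measure.add_apply, measure_univ, measure_univ,
      smul_eq_mul, one_add_one_eq_two, ENNReal.inv_mul_cancel two_ne_zero ENNReal.ofNat_ne_top]⟩⟩
  truthful v i b := by
    rw [integral_utility_thresholdRule, integral_utility_thresholdRule]
    have h : i + 1 ≠ i := by fin_cases i <;> decide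
    rw [Function.update_of_ne h, Function.update_self]
    gcongr 1
    have hlt : t < v i ↔ (t : ℝ) < v i := NNReal.coe_lt_coe.symm
    simp only [hlt]
    split_ifs <;> linarith
  rational v i := by
    rw [thresholdRule_apply]
    refine Measure.ae_smul_measure ?_ _
    rw [ae_add_measure_iff]
    have hm : MeasurableSet {o : Outcome | 0 ≤ utility i (v i) o} :=
      measurableSet_le measurable_const (measurable_utility i (v i))
    exact ⟨(ae_dirac_iff hm).2 (utility_thresholdOutcome_nonneg t v 0 i),
      (ae_dirac_iff hm).2 (utility_thresholdOutcome_nonneg t v 1 i)⟩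

lemma relabel_thresholdOutcome_swap (t : ℝ≥0) (v : Profile) (k : Fin 2) :
    relabel (Equiv.swap 0 1) (thresholdOutcome t v k)
      = thresholdOutcome t (v ∘ Equiv.swap 0 1) (k + 1) := by
  have hk : k + 1 + 1 = k := by fin_cases k <;> rfl
  have hs : ∀ i : Fin 2, Equiv.swap (0 : Fin 2) 1 i = i + 1 := by decide
  have hw : thresholdWinner t (v ∘ Equiv.swap 0 1) (k + 1) = thresholdWinner t v k + 1 := by
    unfold thresholdWinner
    simp only [Function.comp, hs, hk]
    split_ifs <;> simp [hk]
  unfold thresholdOutcome relabel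
  rw [hw]
  refine Prod.ext (by simp [hs]) (funext fun i => ?_)
  have hi : i + 1 + 1 = i := by fin_cases i <;> rfl
  have he : i + 1 = thresholdWinner t v k ↔ i = thresholdWinner t v k + 1 := by
    generalize thresholdWinner t v k = w
    revert i w; decide
  simp [hs, hi, he]

lemma thresholdMechanism_anonymous (t : ℝ≥0) : (thresholdMechanism t).Anonymous := by
  intro σ v
  have hσ : σ = 1 ∨ σ = Equiv.swap 0 1 := by revert σ; decide
  change thresholdRule t (v ∘ σ) = (thresholdRule t v).map (relabel σ)
  rcases hσ with rfl | rfl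
  · have : relabel 1 = id := by
      ext1 o
      exact Prod.ext (by simp [relabel, ← Equiv.Perm.inv_def]) (by simp [relabel])
    rw [this, Measure.map_id, Equiv.Perm.coe_one, Function.comp_id]
  · have hm := measurable_relabel (Equiv.swap 0 1)
    rw [thresholdRule_apply, thresholdRule_apply, Measure.map_smul, Measure.map_add _ _ hm,
      Measure.map_dirac' hm, Measure.map_dirac' hm, relabel_thresholdOutcome_swap,
      relabel_thresholdOutcome_swap, add_comm]
    rfl

lemma surplus_thresholdMechanism (t : ℝ≥0) (v : Profile) :
    (thresholdMechanism t).surplus v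
      = ((if v 1 ≤ t then (v 0 : ℝ) / 2 else 0) + max ((v 0 : ℝ) - t) 0 / 2)
        + ((if v 0 ≤ t then (v 1 : ℝ) / 2 else 0) + max ((v 1 : ℝ) - t) 0 / 2) := by
  have hmax : ∀ x : ℝ≥0, (if t < x then ((x : ℝ) - t) / 2 else 0) = max ((x : ℝ) - t) 0 / 2 := by
    intro x
    split_ifs with h
    · have : (t : ℝ) < x := by exact_mod_cast h
      rw [max_eq_left (by linarith)]
    · have : (x : ℝ) ≤ t := by exact_mod_cast not_lt.1 h
      rw [max_eq_right (by linarith), zero_div]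
  rw [Mechanism.surplus,
    integral_finsetSum _ fun i _ => (thresholdMechanism t).integrable_utility v i (v i),
    Fin.sum_univ_two]
  have h := fun i => integral_utility_thresholdRule t v i (v i)
  simp only [hmax] at h
  exact congrArg₂ (· + ·) (h 0) (h 1)

/-- The part of agent `i`'s utility that comes from a fair coin when agent `j` is not above the
threshold. -/
lemma integral_stdExp_iid_ite {i j : Fin 2} (hij : i ≠ j) (t : ℝ≥0) :
    Integrable (fun v : Profile => if v j ≤ t then (v i : ℝ) / 2 else 0) (iid stdExp) ∧
    ∫ v : Profile, (if v j ≤ t then (v i : ℝ) / 2 else 0) ∂(iid stdExp)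
      = (1 - Real.exp (-t)) / 2 := by
  have hm : MeasurableSet {v : Profile | v j ≤ t} :=
    measurableSet_le (measurable_pi_apply j) measurable_const
  have hint : Integrable (fun v : Profile => if v j ≤ t then (v i : ℝ) / 2 else 0)
      (iid stdExp) := by
    refine (integrable_value i).mono' (Measurable.aestronglyMeasurable
      (Measurable.ite hm (by fun_prop) measurable_const)) (.of_forall fun v => ?_)
    have := (v i).coe_nonneg
    rw [Real.norm_of_nonneg (by positivity)]
    split_ifs <;> linarith
  refine ⟨hint, ?_⟩
  rw [integral_iid_eq_integral_update _ i hint]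
  simp only [Function.update_self, Function.update_of_ne hij.symm]
  have hinner : ∀ w : Profile, ∫ z : ℝ≥0, (if w j ≤ t then (z : ℝ) / 2 else 0) ∂stdExp
      = (Set.Ioi t)ᶜ.indicator (fun _ => (1 : ℝ) / 2) (w j) := by
    intro w
    by_cases hw : w j ≤ t
    · simp [hw, integral_div, integral_stdExp_coe]
    · simp [hw]
  simp only [hinner]
  rw [integral_iid_eval stdExp j (measurable_const.indicator measurableSet_Ioi.compl),
    integral_indicator measurableSet_Ioi.compl, setIntegral_const,
    probReal_compl_eq_one_sub measurableSet_Ioi, stdExp_real_Ioi, smul_eq_mul]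
  ring

/-- The threshold mechanism always allocates the item, so it attains the bound
`Mechanism.expectedSurplus_le_one`, whatever the threshold is. -/
lemma expectedSurplus_thresholdMechanism (t : ℝ≥0) :
    (thresholdMechanism t).expectedSurplus stdExp = 1 := by
  have hmi : ∀ i : Fin 2, Integrable (fun v : Profile => max ((v i : ℝ) - t) 0 / 2)
      (iid stdExp) := by
    intro i
    refine (integrable_value i).mono' (Measurable.aestronglyMeasurable (by fun_prop))
      (.of_forall fun v => ?_)
    have := (v i).coe_nonneg
    rw [Real.norm_of_nonneg (by positivity)]
    have : max ((v i : ℝ) - t) 0 ≤ v i := max_le (by linarith [t.coe_nonneg]) this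
    linarith
  have hm : ∀ i : Fin 2, ∫ v : Profile, max ((v i : ℝ) - t) 0 / 2 ∂(iid stdExp)
      = Real.exp (-t) / 2 := by
    intro i
    rw [integral_div, integral_iid_eval stdExp i (f := fun z => max ((z : ℝ) - t) 0)
      (by fun_prop), integral_stdExp_max_sub]
  obtain ⟨hi0, h0⟩ := integral_stdExp_iid_ite zero_ne_one t
  obtain ⟨hi1, h1⟩ := integral_stdExp_iid_ite one_ne_zero t
  unfold Mechanism.expectedSurplus
  simp only [surplus_thresholdMechanism]
  rw [integral_add ?_ ?_, integral_add hi0 (hmi 0), integral_add hi1 (hmi 1), h0, h1, hm, hm]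
  · ring
  · exact hi0.add (hmi 0)
  · exact hi1.add (hmi 1)

lemma thresholdMechanism_optimalFor (t : ℝ≥0) : (thresholdMechanism t).OptimalFor stdExp :=
  fun M => M.expectedSurplus_le_one.trans_eq (expectedSurplus_thresholdMechanism t).symm

/-- For values `a > b` the threshold `b` yields the surplus `a - b / 2`; with the larger value as
threshold the item goes to a fair coin free of charge, as in the uniform lottery. -/
lemma exists_surplus_thresholdMechanism_eq (v : Profile) :
    ∃ t, (thresholdMechanism t).surplus v = closedForm v := by
  have hle : ∀ i j : Fin 2, v i ≤ v j ↔ (v i : ℝ) ≤ v j := fun i j => NNReal.coe_le_coe.symm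
  have h0 := (v 0).coe_nonneg
  have h1 := (v 1).coe_nonneg
  unfold closedForm
  rcases le_total ((v 0 + v 1 : ℝ) / 4 + 3 / 4 * |(v 0 : ℝ) - v 1|) ((v 0 + v 1 : ℝ) / 2)
    with h | h
  · refine ⟨max (v 0) (v 1), ?_⟩
    rw [surplus_thresholdMechanism, max_eq_right h, NNReal.coe_max]
    simp only [le_max_left, le_max_right, if_true]
    rw [max_eq_right (by linarith [le_max_left (v 0 : ℝ) (v 1)]),
      max_eq_right (by linarith [le_max_right (v 0 : ℝ) (v 1)])]
    ring
  · refine ⟨min (v 0) (v 1), ?_⟩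
    rw [surplus_thresholdMechanism, max_eq_left h, NNReal.coe_min]
    simp only [le_min_iff, hle]
    grind

/-! ### The benchmark in closed form -/

/-- The supremum defining `𝒢` is attained, already by mechanisms optimal for the exponential
law. -/
lemma benchmarkG_eq_closedForm : benchmarkG = closedForm := by
  ext v
  refine IsGreatest.csSup_eq ⟨?_, ?_⟩
  · obtain ⟨t, ht⟩ := exists_surplus_thresholdMechanism_eq v
    exact ⟨stdExp, inferInstance, integrable_stdExp_coe, thresholdMechanism t,
      thresholdMechanism_anonymous t, thresholdMechanism_optimalFor t, ht⟩
  · rintro s ⟨F, -, -, M, hM, -, rfl⟩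
    exact hM.surplus_le v

lemma integrable_closedForm : Integrable closedForm (iid stdExp) :=
  integrable_of_le_add measurable_closedForm closedForm_nonneg closedForm_le_add

lemma integrable_vickreyOrLottery : Integrable vickreyOrLottery (iid stdExp) :=
  integrable_of_le_add measurable_vickreyOrLottery
    (fun _ => (abs_nonneg _).trans (le_max_left _ _))
    fun v => (vickreyOrLottery_le_closedForm v).trans (closedForm_le_add v)

/-- A benchmark of expectation at least `5 / 4` exceeds the optimal expected surplus `1` by that
factor. -/
lemma Mechanism.not_approximatesOn (M : Mechanism) {B : Profile → ℝ}
    (hB : 5 / 4 ≤ ∫ v, B v ∂(iid stdExp)) {ε : ℝ} (hε : 0 < ε) (hε' : ε < 5 / 4) :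
    ¬ M.ApproximatesOn stdExp (5 / 4 - ε) B := by
  intro h
  have h1 := h.trans M.expectedSurplus_le_one
  rw [div_le_one (by linarith)] at h1
  linarith

lemma Mechanism.Approximates.approximatesOn {M : Mechanism} {B : Profile → ℝ} {α : ℝ}
    (hB : Integrable B (iid stdExp)) (h : M.Approximates α B) : M.ApproximatesOn stdExp α B := by
  unfold ApproximatesOn expectedSurplus
  rw [← integral_div]
  exact integral_mono (hB.div_const α) M.integrable_surplus h

end MoneyBurning

theorem mainTheorem10 :
    -- expected surpluses and benchmarks under i.i.d. standard exponential values are genuine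
    (∀ M : MoneyBurning.Mechanism,
      MeasureTheory.Integrable M.surplus (MoneyBurning.iid MoneyBurning.stdExp)) ∧
    MeasureTheory.Integrable MoneyBurning.benchmarkG (MoneyBurning.iid MoneyBurning.stdExp) ∧
    MeasureTheory.Integrable MoneyBurning.vickreyOrLottery
      (MoneyBurning.iid MoneyBurning.stdExp) ∧
    -- the optimal expected surplus is `1`
    IsGreatest {s : ℝ | ∃ M : MoneyBurning.Mechanism,
      M.expectedSurplus MoneyBurning.stdExp = s} 1 ∧
    -- the better of Vickrey and lottery has expectation `5/4` and is dominated by `𝒢`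
    ∫ v, MoneyBurning.vickreyOrLottery v ∂(MoneyBurning.iid MoneyBurning.stdExp) = 5 / 4 ∧
    (∀ v, MoneyBurning.vickreyOrLottery v ≤ MoneyBurning.benchmarkG v) ∧
    5 / 4 ≤ ∫ v, MoneyBurning.benchmarkG v ∂(MoneyBurning.iid MoneyBurning.stdExp) ∧
    -- no mechanism is a `(5/4 - ε)`-approximation, in expectation or at every profile
    ∀ ε : ℝ, 0 < ε → ε < 5 / 4 → ∀ M : MoneyBurning.Mechanism,
      ¬ M.ApproximatesOn MoneyBurning.stdExp (5 / 4 - ε) MoneyBurning.benchmarkG ∧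
      ¬ M.ApproximatesOn MoneyBurning.stdExp (5 / 4 - ε) MoneyBurning.vickreyOrLottery ∧
      ¬ M.Approximates (5 / 4 - ε) MoneyBurning.benchmarkG ∧
      ¬ M.Approximates (5 / 4 - ε) MoneyBurning.vickreyOrLottery := by
  open MoneyBurning in
  have hG : 5 / 4 ≤ ∫ v, benchmarkG v ∂(iid stdExp) := by
    rw [benchmarkG_eq_closedForm, ← integral_vickreyOrLottery]
    exact integral_mono integrable_vickreyOrLottery integrable_closedForm
      vickreyOrLottery_le_closedForm
  have hGi : Integrable MoneyBurning.benchmarkG (MoneyBurning.iid MoneyBurning.stdExp) := by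
    rw [MoneyBurning.benchmarkG_eq_closedForm]
    exact MoneyBurning.integrable_closedForm
  have hHi := MoneyBurning.integrable_vickreyOrLottery
  have hH := MoneyBurning.integral_vickreyOrLottery
  refine ⟨fun M => M.integrable_surplus, hGi, hHi, ⟨?_, ?_⟩, hH, ?_, hG, ?_⟩
  · exact ⟨_, MoneyBurning.expectedSurplus_thresholdMechanism 0⟩
  · rintro s ⟨M, rfl⟩
    exact M.expectedSurplus_le_one
  · rw [MoneyBurning.benchmarkG_eq_closedForm]
    exact MoneyBurning.vickreyOrLottery_le_closedForm
  · intro ε hε hε' M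
    exact ⟨M.not_approximatesOn hG hε hε', M.not_approximatesOn hH.ge hε hε',
      fun h => M.not_approximatesOn hG hε hε' (h.approximatesOn hGi),
      fun h => M.not_approximatesOn hH.ge hε hε' (h.approximatesOn hHi)⟩
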